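/- There are absolute constants $c, C > 0$ such that the following holds. Here a frame is a tuple $V=(v_1,\ldots,v_n)$ of vectors in $\mathbb{R}^d$ with the Euclidean norm. It is called doubly balanced if, with $s=\sum_{i=1}^n \|v_i\|^2$, one has $\sum_{i=1}^n v_i v_i^{T} = \frac{s}{d} I_d$ and $\|v_i\|^2 = \frac{s}{n}$ for every $i$. Its angle is $\theta(V) = \max_{i\neq j} \langle v_i, v_j\rangle^2$ (and $\theta(V)=0$ if $n \le 1$), and $\log$ is the natural logarithm. (1) For all integers $d \ge 1$ and $n \ge c\, d^{4/3}$ there is a doubly balanced frame $V=(v_1,\ldots,v_n)$ of unit vectors in $\mathbb{R}^d$ with $$\theta(V) \le C\left(\frac{\log n}{d} + \frac{d \log^3 d}{n}\right).$$ (2) For every integer $d \ge 1$ there is a doubly balanced frame $V=(v_1,\ldots,v_{d^2})$ of $n=d^2$ unit vectors in $\mathbb{R}^d$ with $$\theta(V) \le C\,\frac{\log^3 d}{d}.$$ -/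

import Mathlib

namespace FrameScaling

/-- A frame: a tuple of `n` vectors in `ℝ^d` with the Euclidean norm. -/
abbrev Frame (n d : ℕ) : Type := Fin n → EuclideanSpace ℝ (Fin d)

/-- The size `s(U) = ∑ i, ‖u i‖²` of a frame. -/
noncomputable def size {n d : ℕ} (U : Frame n d) : ℝ := ∑ i, ‖U i‖ ^ 2

/-- The frame operator `∑ i, u i (u i)ᵀ`, as a `d × d` matrix. -/
noncomputable def frameOperator {n d : ℕ} (U : Frame n d) : Matrix (Fin d) (Fin d) ℝ :=
  ∑ i, Matrix.vecMulVec (U i).ofLp (U i).ofLp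

/-- The `n × n` diagonal matrix of the squared norms of the vectors of a frame. -/
noncomputable def normMatrix {n d : ℕ} (U : Frame n d) : Matrix (Fin n) (Fin n) ℝ :=
  Matrix.diagonal fun i => ‖U i‖ ^ 2

/-- `ε`-nearly doubly balanced frames:
`(1 - ε) (s/d) I ≼ ∑ i, u i (u i)ᵀ ≼ (1 + ε) (s/d) I` and
`(1 - ε) (s/n) I ≼ diag (‖u i‖²) ≼ (1 + ε) (s/n) I`. The Loewner order `A ≼ B` is written as
`(B - A).PosSemidef`. -/
structure IsNearlyDoublyBalanced {n d : ℕ} (ε : ℝ) (U : Frame n d) : Prop where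
  frameOperator_lower :
    (frameOperator U - ((1 - ε) * (size U / d)) • (1 : Matrix (Fin d) (Fin d) ℝ)).PosSemidef
  frameOperator_upper :
    (((1 + ε) * (size U / d)) • (1 : Matrix (Fin d) (Fin d) ℝ) - frameOperator U).PosSemidef
  normMatrix_lower :
    (normMatrix U - ((1 - ε) * (size U / n)) • (1 : Matrix (Fin n) (Fin n) ℝ)).PosSemidef
  normMatrix_upper :
    (((1 + ε) * (size U / n)) • (1 : Matrix (Fin n) (Fin n) ℝ) - normMatrix U).PosSemidef

/-- Doubly balanced frames are the `0`-nearly doubly balanced ones. -/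
def IsDoublyBalanced {n d : ℕ} (U : Frame n d) : Prop := IsNearlyDoublyBalanced 0 U

/-- The angle `θ(V) = max_{i ≠ j} ⟪v i, v j⟫²`. The index set is finite, so the supremum is a
maximum as soon as there is a pair `i ≠ j`; otherwise the angle is `0`. -/
noncomputable def angle {n d : ℕ} (V : Frame n d) : ℝ :=
  ⨆ p : {p : Fin n × Fin n // p.1 ≠ p.2}, (inner ℝ (V p.1.1) (V p.1.2)) ^ 2

end FrameScaling

/-! Restrict the real Fourier (Hartley) basis of `ℤ/m` to a set `S` of `d` frequencies with
`S = -S`. The rows form a tight frame of equal norms, and the inner product of two rows is a cosine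
sum over `S`; if `S` is random, Hoeffding's inequality and a union bound make all these sums
`O(√(m log m))`. This gives `m` unit vectors of angle `O(log m / d)` for `d ≤ m ≤ 2 d`. A larger `n`
is reached by joining blocks: the entries are `O(1 / √d)`, so random sign changes of the coordinates
of one block keep it tight and, by Hoeffding again, make it incoherent with the rest. -/

namespace FrameScaling

open Finset MeasureTheory ProbabilityTheory
open scoped Matrix NNReal Pointwise

section Discrepancy

variable {ι κ : Type*}

theorem measureReal_le_abs_le_of_hasSubgaussianMGF {Ω : Type*} [MeasurableSpace Ω] {μ : Measure Ω}
    {X : Ω → ℝ} {c : ℝ≥0} (hX : HasSubgaussianMGF X c μ) {ε : ℝ}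
    (hε : 0 ≤ ε) : μ.real {ω | ε ≤ |X ω|} ≤ 2 * Real.exp (-ε ^ 2 / (2 * c)) := by
  have hunion : {ω | ε ≤ |X ω|} = {ω | ε ≤ X ω} ∪ {ω | ε ≤ (-X) ω} := by
    ext ω
    exact le_abs (a := ε) (b := X ω)
  rw [hunion, two_mul]
  exact (measureReal_union_le _ _).trans
    (add_le_add (hX.measure_ge_le hε) (hX.neg.measure_ge_le hε))

theorem exists_forall_abs_le_of_hasSubgaussianMGF [Fintype κ] {Ω : Type*} [MeasurableSpace Ω]
    {μ : Measure Ω} [IsProbabilityMeasure μ] {X : κ → Ω → ℝ} {c : ℝ≥0}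
    (hX : ∀ k, HasSubgaussianMGF (X k) c μ) :
    ∃ ω, ∀ k, |X k ω| ≤ 2 * √(c * Real.log (2 * Fintype.card κ)) := by
  rcases eq_or_ne c 0 with rfl | hc
  · obtain ⟨ω, hω⟩ :=
      (ae_all_iff.2 fun k => (hX k).ae_eq_zero_of_hasSubgaussianMGF_zero).exists
    exact ⟨ω, fun k => by simp [hω k]⟩
  rcases isEmpty_or_nonempty κ with hκ | hκ
  · exact ⟨μ.nonempty_of_neZero.some, isEmptyElim⟩
  set ε := 2 * √(c * Real.log (2 * Fintype.card κ)) with hε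
  have hcard : (1 : ℝ) ≤ Fintype.card κ := by exact_mod_cast Fintype.card_pos
  have hlog : 0 ≤ Real.log (2 * Fintype.card κ) := Real.log_nonneg (by linarith)
  have hexp : 2 * Real.exp (-ε ^ 2 / (2 * c)) = 2 / (2 * Fintype.card κ : ℝ) ^ 2 := by
    have hsq : -ε ^ 2 / (2 * c) = -(2 * Real.log (2 * Fintype.card κ)) := by
      rw [hε, mul_pow, Real.sq_sqrt (by positivity)]
      field_simp
    rw [hsq, Real.exp_neg, two_mul (Real.log _), Real.exp_add, Real.exp_log (by positivity), sq]
    rfl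
  have hbad : μ.real (⋃ k, {ω | ε ≤ |X k ω|}) < 1 := by
    calc μ.real (⋃ k, {ω | ε ≤ |X k ω|})
        ≤ ∑ k, μ.real {ω | ε ≤ |X k ω|} := measureReal_iUnion_fintype_le _
      _ ≤ ∑ _k : κ, 2 / (2 * Fintype.card κ : ℝ) ^ 2 := sum_le_sum fun k _ =>
          (measureReal_le_abs_le_of_hasSubgaussianMGF (hX k) (by positivity)).trans hexp.le
      _ = 1 / (2 * Fintype.card κ) := by
          rw [sum_const, card_univ, nsmul_eq_mul]
          field_simp
      _ < 1 := by rw [div_lt_one (by positivity)]; linarith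
  obtain ⟨ω, hω⟩ : ∃ ω, ω ∉ ⋃ k, {ω | ε ≤ |X k ω|} := by
    by_contra! h
    rw [Set.eq_univ_of_forall h, probReal_univ] at hbad
    exact hbad.false
  simp only [Set.mem_iUnion, Set.mem_ofPred_eq, not_exists, not_le] at hω
  exact ⟨ω, fun k => (hω k).le⟩

theorem hasSubgaussianMGF_ite_sub {Ω : Type*} [MeasurableSpace Ω] {μ : Measure Ω}
    {ξ : Ω → Bool} {p : unitInterval} (hlaw : HasLaw ξ Ber(true, false, p) μ) {a : ℝ}
    (ha : |a| ≤ 1) : HasSubgaussianMGF (fun ω => (if ξ ω then a else 0) - p * a) (1 / 4) μ := by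
  have : IsProbabilityMeasure μ := hlaw.isProbabilityMeasure
  let g : Bool → ℝ := fun b => if b then a else 0
  have hmean : ∫ ω, g (ξ ω) ∂μ = p * a := by
    have h := hlaw.integral_comp (f := g) (measurable_of_finite _).aestronglyMeasurable
    rw [integral_bernoulliMeasure] at h
    simpa [g] using h
  have hmem : ∀ b, g b ∈ Set.Icc (min a 0) (min a 0 + 1) := by
    have := abs_le.1 ha
    grind
  have h := hasSubgaussianMGF_of_mem_Icc (μ := μ) (X := fun ω => g (ξ ω))
    ((measurable_of_finite g).comp_aemeasurable hlaw.aemeasurable)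
    (Filter.Eventually.of_forall fun ω => hmem _)
  rw [hmean] at h
  convert h using 1
  rw [add_sub_cancel_left, nnnorm_one]
  norm_num

theorem exists_subset_abs_sum_sub_le [Fintype κ] (H : Finset ι) {f : κ → ι → ℝ}
    (hf : ∀ k i, |f k i| ≤ 1) (p : unitInterval) :
    ∃ T ⊆ H, ∀ k, |∑ i ∈ T, f k i - p * ∑ i ∈ H, f k i|
      ≤ √(#H * Real.log (2 * Fintype.card κ)) := by
  obtain ⟨Ω, _, μ, ξ, -, hlaw, hindep, _⟩ := exists_iid ι Ber(true, false, p)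
  have hsum (k : κ) :
      HasSubgaussianMGF (fun ω => ∑ i ∈ H, ((if ξ i ω then f k i else 0) - p * f k i))
        (∑ _i ∈ H, 1 / 4) μ :=
    HasSubgaussianMGF.sum_of_iIndepFun
      (hindep.comp (fun i (b : Bool) => (if b then f k i else 0) - p * f k i)
        fun i => measurable_of_finite _)
      fun i _ => hasSubgaussianMGF_ite_sub (hlaw i) (hf k i)
  obtain ⟨ω, hω⟩ := exists_forall_abs_le_of_hasSubgaussianMGF hsum
  refine ⟨{i ∈ H | ξ i ω}, filter_subset _ _, fun k => ?_⟩
  have hvar : ((∑ _i ∈ H, (1 / 4 : ℝ≥0) : ℝ≥0) : ℝ) = #H / 2 ^ 2 := by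
    simp
    ring
  have h := hω k
  rwa [hvar, div_mul_eq_mul_div, Real.sqrt_div' _ (by positivity), Real.sqrt_sq two_pos.le,
    mul_div_cancel₀ _ two_ne_zero, sum_sub_distrib, ← mul_sum, ← sum_filter] at h

theorem exists_sign_abs_sum_le [Fintype ι] [Fintype κ] {f : κ → ι → ℝ}
    (hf : ∀ k i, |f k i| ≤ 1) :
    ∃ ε : ι → ℝ, (∀ i, ε i ^ 2 = 1) ∧
      ∀ k, |∑ i, ε i * f k i| ≤ 2 * √(Fintype.card ι * Real.log (2 * Fintype.card κ)) := by
  classical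
  obtain ⟨T, -, hT⟩ := exists_subset_abs_sum_sub_le univ hf
    ⟨1 / 2, by norm_num, by norm_num⟩
  refine ⟨fun i => if i ∈ T then 1 else -1, fun i => ?_, fun k => ?_⟩
  · dsimp only
    split_ifs <;> norm_num
  have hsum : ∑ i, (if i ∈ T then (1 : ℝ) else -1) * f k i
      = 2 * (∑ i ∈ T, f k i - 1 / 2 * ∑ i, f k i) := by
    have hT_sum : ∑ i ∈ T, f k i = ∑ i, if i ∈ T then f k i else 0 := by simp
    rw [hT_sum, mul_sub, mul_sum, ← mul_assoc, mul_sum, ← sum_sub_distrib]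
    refine sum_congr rfl fun i _ => ?_
    split_ifs <;> ring
  rw [hsum, abs_mul, abs_two]
  exact mul_le_mul_of_nonneg_left (hT k) two_pos.le

theorem abs_sum_le_card {f : ι → ℝ} (hf : ∀ i, |f i| ≤ 1) (T : Finset ι) :
    |∑ i ∈ T, f i| ≤ #T :=
  (abs_sum_le_sum_abs _ _).trans (by simpa using sum_le_card_nsmul T _ 1 fun i _ => hf i)

theorem exists_subset_card_eq_abs_sum_sub_sum_le {H T₀ : Finset ι} (hT₀ : T₀ ⊆ H)
    {t : ℕ} (ht : t ≤ #H) :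
    ∃ T ⊆ H, #T = t ∧ ∀ f : ι → ℝ, (∀ i, |f i| ≤ 1) →
      |∑ i ∈ T, f i - ∑ i ∈ T₀, f i| ≤ |(#T₀ : ℝ) - t| := by
  classical
  rcases le_total t #T₀ with h | h
  · obtain ⟨T, hT, hcard⟩ := exists_subset_card_eq h
    refine ⟨T, hT.trans hT₀, hcard, fun f hf => ?_⟩
    have hbound := abs_sum_le_card hf (T₀ \ T)
    rw [card_sdiff_of_subset hT, hcard, Nat.cast_sub h] at hbound
    rw [abs_sub_comm, ← sum_sdiff hT, add_sub_cancel_right]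
    exact hbound.trans (le_abs_self _)
  · obtain ⟨T, hT₀T, hT, hcard⟩ := exists_subsuperset_card_eq hT₀ h ht
    refine ⟨T, hT, hcard, fun f hf => ?_⟩
    have hbound := abs_sum_le_card hf (T \ T₀)
    rw [card_sdiff_of_subset hT₀T, hcard, Nat.cast_sub h] at hbound
    rw [← sum_sdiff hT₀T, add_sub_cancel_right, abs_sub_comm (#T₀ : ℝ)]
    exact hbound.trans (le_abs_self _)

theorem exists_subset_card_eq_abs_sum_sub_le [Fintype κ] {H : Finset ι} {t : ℕ} (ht : t ≤ #H)
    {f : κ → ι → ℝ} (hf : ∀ k i, |f k i| ≤ 1) :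
    ∃ T ⊆ H, #T = t ∧ ∀ k, |∑ i ∈ T, f k i - t / #H * ∑ i ∈ H, f k i|
      ≤ 2 * √(#H * Real.log (2 * (Fintype.card κ + 1))) := by
  classical
  -- The constant function `1` in the family controls the cardinality of the random subset.
  let g : Option κ → ι → ℝ := fun k i => k.elim 1 (f · i)
  have hg : ∀ k i, |g k i| ≤ 1 := by rintro (_ | k) i <;> simp [g, hf]
  obtain ⟨T₀, hT₀, hdisc⟩ := exists_subset_abs_sum_sub_le H hg
    ⟨t / #H, by positivity, div_le_one_of_le₀ (by exact_mod_cast ht) (by positivity)⟩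
  obtain ⟨T, hT, hcard, hclose⟩ := exists_subset_card_eq_abs_sum_sub_sum_le hT₀ ht
  have hmul : (t / #H * #H : ℝ) = t :=
    div_mul_cancel_of_imp fun h => by
      have : #H = 0 := by exact_mod_cast h
      exact_mod_cast (by omega : t = 0)
  have hcard₀ := hdisc none
  simp only [g, Option.elim_none, sum_const, nsmul_eq_mul, mul_one, hmul] at hcard₀
  rw [Fintype.card_option, Nat.cast_add_one] at hdisc hcard₀
  refine ⟨T, hT, hcard, fun k => ?_⟩
  calc |∑ i ∈ T, f k i - t / #H * ∑ i ∈ H, f k i|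
      ≤ |∑ i ∈ T, f k i - ∑ i ∈ T₀, f k i| + |∑ i ∈ T₀, f k i - t / #H * ∑ i ∈ H, f k i| :=
        abs_sub_le _ _ _
    _ ≤ √(#H * Real.log (2 * (Fintype.card κ + 1))) + √(#H * Real.log (2 * (Fintype.card κ + 1))) :=
        add_le_add ((hclose _ (hf k)).trans hcard₀) (hdisc (some k))
    _ = 2 * √(#H * Real.log (2 * (Fintype.card κ + 1))) := (two_mul _).symm

end Discrepancy

section NegInvariant

variable {α : Type*} [DecidableEq α] [InvolutiveNeg α]

theorem sum_union_union_neg {R : Type*} [NonAssocSemiring R] {Z H : Finset α}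
    (hZ : ∀ a ∈ Z, -a = a) (hH : ∀ a ∈ H, -a ∉ H) {f : α → R} (hf : ∀ a, f (-a) = f a) :
    ∑ a ∈ Z ∪ (H ∪ -H), f a = ∑ a ∈ Z, f a + 2 * ∑ a ∈ H, f a := by
  have hdisjH : Disjoint H (-H) := disjoint_left.2 fun a ha ha' => hH a ha (mem_neg'.1 ha')
  have hdisjZ : Disjoint Z (H ∪ -H) := by
    refine disjoint_left.2 fun a ha ha' => ?_
    rw [mem_union, mem_neg', hZ a ha, or_self] at ha'
    exact hH a ha' ((hZ a ha).symm ▸ ha')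
  have hneg : ∑ a ∈ -H, f a = ∑ a ∈ H, f a := by
    rw [← image_neg_eq_neg, sum_image neg_injective.injOn]
    exact sum_congr rfl fun a _ => hf a
  rw [sum_union hdisjZ, sum_union hdisjH, hneg, two_mul]

theorem card_union_union_neg {Z H : Finset α} (hZ : ∀ a ∈ Z, -a = a) (hH : ∀ a ∈ H, -a ∉ H) :
    #(Z ∪ (H ∪ -H)) = #Z + 2 * #H := by
  simpa only [card_eq_sum_ones] using sum_union_union_neg hZ hH (f := fun _ => 1) fun _ => rfl

theorem exists_filter_union_union_neg_eq_univ [Fintype α] :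
    ∃ H : Finset α, (∀ a ∈ H, -a ∉ H) ∧ ({a | -a = a} : Finset α) ∪ (H ∪ -H) = univ := by
  let e := Fintype.equivFin α
  refine ⟨({a | e a < e (-a)} : Finset α), fun a => ?_, eq_univ_of_forall fun a => ?_⟩
  · simp only [mem_filter_univ, neg_neg, not_lt]
    exact le_of_lt
  · simp only [mem_union, mem_neg', mem_filter_univ, neg_neg, ← ne_iff_lt_or_gt,
      e.injective.ne_iff]
    exact (eq_or_ne (-a) a).imp_right Ne.symm

theorem abs_add_two_mul_le {x y u v r : ℝ} (hr : |r| ≤ 1) (hyv : y + 2 * v = 0) :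
    |x + 2 * u| ≤ |x| + |y| + 2 * |u - r * v| := by
  calc |x + 2 * u| = |x - r * y + 2 * (u - r * v)| := by
        congr 1
        linear_combination r * hyv
    _ ≤ |x| + |r| * |y| + 2 * |u - r * v| := by
        rw [← abs_mul, ← abs_two, ← abs_mul, abs_two]
        exact (abs_add_le _ _).trans (add_le_add_left (abs_sub _ _) _)
    _ ≤ |x| + |y| + 2 * |u - r * v| := by
        gcongr
        exact mul_le_of_le_one_left (abs_nonneg y) hr

theorem exists_neg_invariant_card_eq_abs_sum_le {κ : Type*} [Fintype α] [Fintype κ] {d : ℕ}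
    (hd : d ≤ Fintype.card α) (hfix : ∃ a : α, -a = a) {f : κ → α → ℝ}
    (hf : ∀ k a, |f k a| ≤ 1) (hf_even : ∀ k a, f k (-a) = f k a)
    (hf_sum : ∀ k, ∑ a, f k a = 0) :
    ∃ S : Finset α, #S = d ∧ (∀ a ∈ S, -a ∈ S) ∧
      ∀ k, |∑ a ∈ S, f k a| ≤ 2 * #{a : α | -a = a}
        + 4 * √(Fintype.card α * Real.log (2 * (Fintype.card κ + 1))) := by
  obtain ⟨H, hH, huniv⟩ := exists_filter_union_union_neg_eq_univ (α := α)
  set Z : Finset α := {a | -a = a}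
  have hZ : ∀ a ∈ Z, -a = a := fun a => (mem_filter_univ a).1
  have hZpos : 0 < #Z := card_pos.2 (hfix.imp fun a => (mem_filter_univ a).2)
  have hcard : Fintype.card α = #Z + 2 * #H := by
    rw [← card_univ, ← huniv, card_union_union_neg hZ hH]
  let t := min (d / 2) #H
  obtain ⟨T, hTH, hT, hdisc⟩ := exists_subset_card_eq_abs_sum_sub_le (min_le_right (d / 2) #H) hf
  obtain ⟨Z', hZ'Z, hZ'⟩ := exists_subset_card_eq (by lia : d - 2 * t ≤ #Z)
  have hfixed : ∀ a ∈ Z', -a = a := fun a ha => hZ a (hZ'Z ha)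
  have hfree : ∀ a ∈ T, -a ∉ T := fun a ha h => hH a (hTH ha) (hTH h)
  refine ⟨Z' ∪ (T ∪ -T), ?_, fun a ha => ?_, fun k => ?_⟩
  · rw [card_union_union_neg hfixed hfree, hT, hZ']
    lia
  · simp only [mem_union, mem_neg', neg_neg] at ha ⊢
    exact ha.imp (fun h => (hfixed a h).symm ▸ h) Or.symm
  · have hsum : ∑ a ∈ Z, f k a + 2 * ∑ a ∈ H, f k a = 0 := by
      rw [← sum_union_union_neg hZ hH (hf_even k), huniv, hf_sum]
    have hratio : |(t / #H : ℝ)| ≤ 1 := by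
      rw [abs_of_nonneg (by positivity)]
      exact div_le_one_of_le₀ (by exact_mod_cast min_le_right _ _) (by positivity)
    have hlog : 0 ≤ Real.log (2 * (Fintype.card κ + 1)) :=
      Real.log_nonneg (by linarith [(Fintype.card κ).cast_nonneg (α := ℝ)])
    rw [sum_union_union_neg hfixed hfree (hf_even k)]
    calc |∑ a ∈ Z', f k a + 2 * ∑ a ∈ T, f k a|
        ≤ |∑ a ∈ Z', f k a| + |∑ a ∈ Z, f k a|
            + 2 * |∑ a ∈ T, f k a - t / #H * ∑ a ∈ H, f k a| := abs_add_two_mul_le hratio hsum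
      _ ≤ #Z + #Z + 2 * (2 * √(Fintype.card α * Real.log (2 * (Fintype.card κ + 1)))) := by
          gcongr
          · exact (abs_sum_le_card (hf k) Z').trans (by exact_mod_cast card_le_card hZ'Z)
          · exact abs_sum_le_card (hf k) Z
          · refine (hdisc k).trans ?_
            gcongr
            exact card_le_univ H
      _ = 2 * #Z + 4 * √(Fintype.card α * Real.log (2 * (Fintype.card κ + 1))) := by ring

end NegInvariant

section FlatTight

variable {ι κ J : Type*}

/-- The rows of `V` form a tight frame of unit vectors whose entries are `O(1 / √#J)` and whose
coherence, the largest squared inner product of two distinct rows, is at most `B`. Flatness is what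
makes the rows of two such matrices incoherent after random sign changes of the columns. -/
structure IsFlatTight [Fintype ι] [Fintype J] [DecidableEq J] (B : ℝ) (V : Matrix ι J ℝ) :
    Prop where
  tight : Vᵀ * V = (Fintype.card ι / Fintype.card J : ℝ) • (1 : Matrix J J ℝ)
  unit (i : ι) : (V * Vᵀ) i i = 1
  flat (i : ι) (j : J) : V i j ^ 2 ≤ 2 / Fintype.card J
  coherence {i i' : ι} (h : i ≠ i') : (V * Vᵀ) i i' ^ 2 ≤ B

namespace IsFlatTight

variable [Fintype ι] [Fintype κ] [Fintype J] [DecidableEq J] {B : ℝ}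
  {V : Matrix ι J ℝ} {W : Matrix κ J ℝ}

theorem mono (hV : IsFlatTight B V) {B' : ℝ} (h : B ≤ B') : IsFlatTight B' V where
  __ := hV
  coherence hi := (hV.coherence hi).trans h

theorem submatrix (hV : IsFlatTight B V) {ι' J' : Type*} [Fintype ι'] [Fintype J']
    [DecidableEq J'] (e : ι' ≃ ι) (e' : J' ≃ J) : IsFlatTight B (V.submatrix e e') where
  tight := by
    rw [Matrix.transpose_submatrix, Matrix.submatrix_mul_equiv, hV.tight,
      ← Matrix.submatrix_one_equiv e', Fintype.card_congr e, Fintype.card_congr e']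
    rfl
  unit i := by
    rw [Matrix.transpose_submatrix, Matrix.submatrix_mul_equiv, Matrix.submatrix_apply, hV.unit]
  flat i j := by
    rw [Fintype.card_congr e']
    exact hV.flat (e i) (e' j)
  coherence h := by
    rw [Matrix.transpose_submatrix, Matrix.submatrix_mul_equiv, Matrix.submatrix_apply]
    exact hV.coherence (e.injective.ne h)

theorem mul_diagonal (hW : IsFlatTight B W) {ε : J → ℝ} (hε : ∀ j, ε j ^ 2 = 1) :
    IsFlatTight B (W * Matrix.diagonal ε) := by
  have hdiag : Matrix.diagonal ε * Matrix.diagonal ε = 1 := by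
    rw [Matrix.diagonal_mul_diagonal, ← Matrix.diagonal_one]
    simp only [← sq, hε]
  have hgram : W * Matrix.diagonal ε * (W * Matrix.diagonal ε)ᵀ = W * Wᵀ := by
    rw [Matrix.transpose_mul, Matrix.diagonal_transpose, Matrix.mul_assoc,
      ← Matrix.mul_assoc (Matrix.diagonal ε), hdiag, Matrix.one_mul]
  constructor
  · rw [Matrix.transpose_mul, Matrix.diagonal_transpose, Matrix.mul_assoc, ← Matrix.mul_assoc Wᵀ,
      hW.tight, Matrix.smul_mul, Matrix.mul_smul, Matrix.one_mul, hdiag]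
  · exact fun i => hgram ▸ hW.unit i
  · intro i j
    rw [Matrix.mul_diagonal, mul_pow, hε, mul_one]
    exact hW.flat i j
  · exact fun h => hgram ▸ hW.coherence h

theorem fromRows (hV : IsFlatTight B V) (hW : IsFlatTight B W)
    (hcross : ∀ i k, (V * Wᵀ) i k ^ 2 ≤ B) : IsFlatTight B (Matrix.fromRows V W) := by
  have hgram : Matrix.fromRows V W * (Matrix.fromRows V W)ᵀ
      = Matrix.fromBlocks (V * Vᵀ) (V * Wᵀ) (W * Vᵀ) (W * Wᵀ) := by
    rw [Matrix.transpose_fromRows, Matrix.fromRows_mul_fromCols]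
  constructor
  · rw [Matrix.transpose_fromRows, Matrix.fromCols_mul_fromRows, hV.tight, hW.tight, ← add_smul,
      ← add_div, Fintype.card_sum, Nat.cast_add]
  · rw [hgram]
    rintro (i | k)
    · exact hV.unit i
    · exact hW.unit k
  · rintro (i | k) j
    · exact hV.flat i j
    · exact hW.flat k j
  · rw [hgram]
    rintro (i | k) (i' | k') h
    · exact hV.coherence (ne_of_apply_ne Sum.inl h)
    · exact hcross i k'
    · rw [Matrix.fromBlocks_apply₂₁, ← Matrix.transpose_apply (W * Vᵀ), Matrix.transpose_mul,
        Matrix.transpose_transpose]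
      exact hcross i' k
    · exact hW.coherence (ne_of_apply_ne Sum.inr h)

theorem abs_card_div_two_mul_le_one {B' : ℝ} (hV : IsFlatTight B V) (hW : IsFlatTight B' W)
    (i : ι) (k : κ) (j : J) : |(Fintype.card J / 2 : ℝ) * (V i j * W k j)| ≤ 1 := by
  have : Nonempty J := ⟨j⟩
  have hmul : |V i j * W k j| ≤ 2 / Fintype.card J := by
    rw [abs_mul]
    linarith [two_mul_le_add_sq |V i j| |W k j|, sq_abs (V i j), sq_abs (W k j), hV.flat i j,
      hW.flat k j]
  rw [abs_mul, abs_of_pos (by positivity)]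
  calc Fintype.card J / 2 * |V i j * W k j| ≤ Fintype.card J / 2 * (2 / Fintype.card J) := by gcongr
    _ = 1 := by field_simp

theorem exists_sign_cross_sq_le {B' : ℝ} (hV : IsFlatTight B V) (hW : IsFlatTight B' W) :
    ∃ ε : J → ℝ, (∀ j, ε j ^ 2 = 1) ∧ ∀ i k, (V * (W * Matrix.diagonal ε)ᵀ) i k ^ 2
      ≤ 16 * Real.log (2 * (Fintype.card ι * Fintype.card κ)) / Fintype.card J := by
  obtain ⟨ε, hε, hsum⟩ := exists_sign_abs_sum_le
    (f := fun (p : ι × κ) j => (Fintype.card J / 2 : ℝ) * (V p.1 j * W p.2 j))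
    fun p j => hV.abs_card_div_two_mul_le_one hW p.1 p.2 j
  refine ⟨ε, hε, fun i k => ?_⟩
  rcases isEmpty_or_nonempty J with _ | _
  · simp [Matrix.mul_apply]
  have hJ : (0 : ℝ) < Fintype.card J := by exact_mod_cast Fintype.card_pos
  have hcross : ∑ j, ε j * ((Fintype.card J / 2 : ℝ) * (V i j * W k j))
      = Fintype.card J / 2 * (V * (W * Matrix.diagonal ε)ᵀ) i k := by
    rw [Matrix.mul_apply, mul_sum]
    refine sum_congr rfl fun j _ => ?_
    rw [Matrix.transpose_apply, Matrix.mul_diagonal]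
    ring
  have hlog : 0 ≤ Real.log (2 * (Fintype.card ι * Fintype.card κ)) := by
    rw [← Nat.cast_mul]
    exact Real.log_nonneg <| by exact_mod_cast
      (Nat.mul_pos two_pos (Nat.mul_pos (Fintype.card_pos_iff.2 ⟨i⟩) (Fintype.card_pos_iff.2 ⟨k⟩)))
  have h := hsum (i, k)
  rw [hcross, Fintype.card_prod, Nat.cast_mul, ← abs_of_nonneg (by positivity : 0 ≤ 2 * √_),
    ← sq_le_sq, mul_pow, mul_pow, Real.sq_sqrt (by positivity)] at h
  rw [le_div_iff₀ hJ]
  refine le_of_mul_le_mul_left ?_ hJ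
  linarith

theorem exists_sum (hV : IsFlatTight B V) (hW : IsFlatTight B W)
    (hB : 16 * Real.log (2 * (Fintype.card ι * Fintype.card κ)) / Fintype.card J ≤ B) :
    ∃ U : Matrix (ι ⊕ κ) J ℝ, IsFlatTight B U := by
  obtain ⟨ε, hε, hcross⟩ := hV.exists_sign_cross_sq_le hW
  exact ⟨_, hV.fromRows (hW.mul_diagonal hε) fun i k => (hcross i k).trans hB⟩

end IsFlatTight

end FlatTight

theorem four_add_four_mul_sqrt_le {d m : ℕ} (hd : 1 ≤ d) (hm : 2 ≤ m) (hmd : m ≤ 2 * d) :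
    4 + 4 * √(m * Real.log (2 * m)) ≤ 16 * √(d * Real.log m) := by
  have hd' : (1 : ℝ) ≤ d := by exact_mod_cast hd
  have hm' : (2 : ℝ) ≤ m := by exact_mod_cast hm
  have hmd' : (m : ℝ) ≤ 2 * d := by exact_mod_cast hmd
  have hlog2 : Real.log 2 ≤ Real.log m := Real.log_le_log two_pos hm'
  have hlog : 1 / 2 ≤ Real.log m := by linarith [Real.log_two_gt_d9]
  have hone : 1 / 2 ≤ √(d * Real.log m) := Real.le_sqrt_of_sq_le (by nlinarith)
  have htwo : √(m * Real.log (2 * m)) ≤ 2 * √(d * Real.log m) := by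
    refine Real.sqrt_le_iff.2 ⟨by positivity, ?_⟩
    rw [mul_pow, Real.sq_sqrt (by positivity), Real.log_mul two_ne_zero (by positivity)]
    nlinarith
  linarith

theorem abs_re_addChar_le_one {G : Type*} [AddLeftCancelMonoid G] [Finite G] (χ : AddChar G ℂ)
    (a : G) : |(χ a).re| ≤ 1 :=
  (Complex.abs_re_le_norm _).trans_eq (AddChar.norm_apply χ a)

theorem sum_im_addChar_eq_zero {G : Type*} [AddCommGroup G] [Finite G] (χ : AddChar G ℂ)
    {S : Finset G} (hS : ∀ s ∈ S, -s ∈ S) : ∑ s ∈ S, (χ s).im = 0 := by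
  have h : ∑ s ∈ S, (χ s).im = ∑ s ∈ S, -(χ s).im := by
    refine sum_nbij' (-·) (-·) hS hS (by simp) (by simp) fun s _ => ?_
    rw [AddChar.map_neg_eq_conj, Complex.conj_im, neg_neg]
  rw [sum_neg_distrib] at h
  linarith

section Hartley

variable {m : ℕ} [NeZero m]

/-- The rows of the discrete Hartley transform on `ZMod m`, with entries
`cos (2 π i s / m) + sin (2 π i s / m)`, restricted to the frequencies `s ∈ S` and normalised. -/
noncomputable def hartley (S : Finset (ZMod m)) : Matrix (ZMod m) S ℝ :=
  Matrix.of fun i s =>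
    ((ZMod.stdAddChar (i * (s : ZMod m))).re + (ZMod.stdAddChar (i * (s : ZMod m))).im) / √(#S : ℝ)

theorem hartley_mul_hartley {S : Finset (ZMod m)} (i i' : ZMod m) (s s' : S) :
    hartley S i s * hartley S i' s'
      = ((ZMod.stdAddChar (i * s - i' * s' : ZMod m)).re
        + (ZMod.stdAddChar (i * s + i' * s' : ZMod m)).im) / #S := by
  rw [hartley, Matrix.of_apply, Matrix.of_apply, div_mul_div_comm,
    Real.mul_self_sqrt (Nat.cast_nonneg _), sub_eq_add_neg, AddChar.map_add_eq_mul,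
    AddChar.map_add_eq_mul, AddChar.map_neg_eq_conj]
  congr 1
  simp only [Complex.mul_re, Complex.mul_im, Complex.conj_re, Complex.conj_im]
  ring

theorem sum_stdAddChar_mul (k : ZMod m) :
    ∑ i : ZMod m, ZMod.stdAddChar (i * k) = if k = 0 then (m : ℂ) else 0 := by
  simpa using AddChar.sum_mulShift k (ZMod.isPrimitive_stdAddChar m)

theorem hartley_transpose_mul_self (S : Finset (ZMod m)) :
    (hartley S)ᵀ * hartley S = (m / #S : ℝ) • (1 : Matrix S S ℝ) := by
  ext s s'
  have hre (k : ZMod m) := congrArg Complex.re (sum_stdAddChar_mul k)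
  have him (k : ZMod m) := congrArg Complex.im (sum_stdAddChar_mul k)
  simp only [Complex.re_sum, Complex.im_sum] at hre him
  simp only [Matrix.mul_apply, Matrix.transpose_apply, hartley_mul_hartley, ← sum_div,
    sum_add_distrib, ← mul_sub, ← mul_add, hre, him, Matrix.smul_apply, Matrix.one_apply]
  simp only [sub_eq_zero, Subtype.coe_inj]
  split_ifs <;> simp

theorem hartley_mul_transpose_apply {S : Finset (ZMod m)} (hS : ∀ s ∈ S, -s ∈ S)
    (i i' : ZMod m) :
    (hartley S * (hartley S)ᵀ) i i'
      = (∑ s ∈ S, (ZMod.stdAddChar ((i - i') * s)).re) / #S := by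
  have him := sum_im_addChar_eq_zero (ZMod.stdAddChar.mulShift (i + i')) hS
  simp only [AddChar.mulShift_apply] at him
  simp only [Matrix.mul_apply, Matrix.transpose_apply, hartley_mul_hartley, ← sum_div,
    sum_add_distrib, ← sub_mul, ← add_mul]
  rw [sum_coe_sort S fun s => (ZMod.stdAddChar ((i - i') * s)).re,
    sum_coe_sort S fun s => (ZMod.stdAddChar ((i + i') * s)).im,
    him, add_zero]

theorem hartley_sq_le (S : Finset (ZMod m)) (i : ZMod m) (s : S) :
    hartley S i s ^ 2 ≤ 2 / #S := by
  rw [sq, hartley_mul_hartley]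
  gcongr
  have him := (le_abs_self _).trans <| (Complex.abs_im_le_norm _).trans_eq
    (AddChar.norm_apply ZMod.stdAddChar (i * s + i * s : ZMod m))
  rw [sub_self, AddChar.map_zero_eq_one, Complex.one_re]
  linarith

theorem isFlatTight_hartley {S : Finset (ZMod m)} (hS₀ : S.Nonempty) (hS : ∀ s ∈ S, -s ∈ S) {B : ℝ}
    (hB : ∀ k ≠ 0, |∑ s ∈ S, (ZMod.stdAddChar (k * s)).re| ≤ B) :
    IsFlatTight (B ^ 2 / #S ^ 2) (hartley S) where
  tight := by rw [hartley_transpose_mul_self, ZMod.card, Fintype.card_coe]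
  unit i := by
    rw [hartley_mul_transpose_apply hS]
    simp [hS₀.ne_empty]
  flat i s := by simpa using hartley_sq_le S i s
  coherence h := by
    rw [hartley_mul_transpose_apply hS, div_pow, ← sq_abs (∑ s ∈ S, _)]
    gcongr
    exact hB _ (sub_ne_zero.2 h)

theorem card_filter_neg_eq_le_two : #{a : ZMod m | -a = a} ≤ 2 := by
  have h := IsAddCyclic.card_nsmul_eq_zero_le (α := ZMod m) two_pos
  convert h using 3
  rw [two_nsmul, neg_eq_iff_add_eq_zero]

theorem exists_neg_invariant_frequencies {d : ℕ} (hd : 1 ≤ d) (hdm : d ≤ m) (hmd : m ≤ 2 * d) :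
    ∃ S : Finset (ZMod m), #S = d ∧ (∀ s ∈ S, -s ∈ S) ∧
      ∀ k ≠ 0, |∑ s ∈ S, (ZMod.stdAddChar (k * s)).re| ≤ 16 * √(d * Real.log m) := by
  obtain ⟨S, hcard, hS, hsum⟩ := exists_neg_invariant_card_eq_abs_sum_le (d := d)
    (f := fun (k : {k : ZMod m // k ≠ 0}) (s : ZMod m) => (ZMod.stdAddChar ((k : ZMod m) * s)).re)
    (by rwa [ZMod.card]) ⟨0, neg_zero⟩ (fun _ _ => abs_re_addChar_le_one _ _)
    (fun k s => by rw [mul_neg, AddChar.map_neg_eq_conj, Complex.conj_re])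
    (fun k => by
      simpa [k.2, mul_comm] using congrArg Complex.re (sum_stdAddChar_mul (k : ZMod m)))
  refine ⟨S, hcard, hS, fun k hk => (hsum ⟨k, hk⟩).trans ?_⟩
  have hm : 1 < m := by
    have : Nontrivial (ZMod m) := ⟨k, 0, hk⟩
    simpa only [ZMod.card] using Fintype.one_lt_card (α := ZMod m)
  have hκ : (Fintype.card {k : ZMod m // k ≠ 0} : ℝ) + 1 = m := by
    rw [Fintype.card_subtype_compl, ZMod.card, Fintype.card_subtype_eq]
    push_cast [NeZero.one_le]
    ring
  have hZ : (#{a : ZMod m | -a = a} : ℝ) ≤ 2 := by exact_mod_cast card_filter_neg_eq_le_two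
  rw [ZMod.card, hκ]
  linarith [four_add_four_mul_sqrt_le hd hm hmd]

theorem exists_isFlatTight_of_le_two_mul {d : ℕ} (hd : 1 ≤ d) (hdm : d ≤ m) (hmd : m ≤ 2 * d) :
    ∃ V : Matrix (Fin m) (Fin d) ℝ, IsFlatTight (256 * Real.log m / d) V := by
  obtain ⟨S, hcard, hS, hsum⟩ := exists_neg_invariant_frequencies hd hdm hmd
  have hV := isFlatTight_hartley (card_pos.1 (by omega)) hS hsum
  refine ⟨_, (hV.submatrix (ZMod.finEquiv m).toEquiv (S.equivFinOfCardEq hcard).symm).mono ?_⟩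
  rw [hcard, mul_pow, Real.sq_sqrt (by positivity)]
  refine le_of_eq ?_
  field_simp
  norm_num [mul_comm]

end Hartley

theorem exists_isFlatTight {d N n : ℕ} (hd : 1 ≤ d) (hdn : d ≤ n) (hnN : n ≤ N) :
    ∃ V : Matrix (Fin n) (Fin d) ℝ, IsFlatTight (256 * Real.log N / d) V := by
  have hblock (m : ℕ) (hdm : d ≤ m) (hmd : m ≤ 2 * d) (hmN : m ≤ N) :
      ∃ V : Matrix (Fin m) (Fin d) ℝ, IsFlatTight (256 * Real.log N / d) V := by
    have : NeZero m := ⟨by omega⟩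
    obtain ⟨V, hV⟩ := exists_isFlatTight_of_le_two_mul hd hdm hmd
    refine ⟨V, hV.mono ?_⟩
    gcongr
    exact_mod_cast NeZero.pos m
  induction n using Nat.strong_induction_on with
  | _ n ih =>
    rcases le_or_gt n (2 * d) with hnd | hnd
    · exact hblock n hdn hnd hnN
    · obtain ⟨k, rfl⟩ : ∃ k, n = k + d := ⟨n - d, by omega⟩
      obtain ⟨V, hV⟩ := ih k (by omega) (by omega) (by omega)
      obtain ⟨W, hW⟩ := hblock d le_rfl (by omega) (by omega)
      have hlog : Real.log (2 * (k * d)) ≤ 2 * Real.log N := by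
        have hkd : 2 * (k * d) ≤ N ^ 2 := by nlinarith [sq_nonneg ((k : ℤ) - d)]
        calc Real.log (2 * (k * d)) ≤ Real.log (N ^ 2) := by
              have hk : 0 < k := by omega
              refine Real.log_le_log (by positivity) (by exact_mod_cast hkd)
          _ = 2 * Real.log N := by simp
      obtain ⟨U, hU⟩ := hV.exists_sum hW <| by
        rw [Fintype.card_fin, Fintype.card_fin]
        refine div_le_div_of_nonneg_right ?_ d.cast_nonneg
        linarith [Real.log_natCast_nonneg N]
      exact ⟨_, hU.submatrix finSumFinEquiv.symm (Equiv.refl _)⟩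

theorem isDoublyBalanced_of_frameOperator_eq {n d : ℕ} {U : Frame n d} (hu : ∀ i, ‖U i‖ = 1)
    (hU : frameOperator U = (n / d : ℝ) • (1 : Matrix (Fin d) (Fin d) ℝ)) :
    IsDoublyBalanced U := by
  have hsize : size U = n := by simp [size, hu]
  have hnorm : normMatrix U = (n / n : ℝ) • (1 : Matrix (Fin n) (Fin n) ℝ) := by
    rcases eq_or_ne n 0 with rfl | hn
    · exact Subsingleton.elim _ _
    · simp [normMatrix, hu, hn]
  constructor <;> simp only [hsize, hU, hnorm, sub_zero, add_zero, one_mul, sub_self] <;>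
    exact Matrix.PosSemidef.zero

theorem angle_le {n d : ℕ} {U : Frame n d} {B : ℝ} (hB : 0 ≤ B)
    (h : ∀ i i', i ≠ i' → inner ℝ (U i) (U i') ^ 2 ≤ B) : angle U ≤ B :=
  Real.iSup_le (fun p => h _ _ p.2) hB

theorem inner_toLp_row {n d : ℕ} (V : Matrix (Fin n) (Fin d) ℝ) (i i' : Fin n) :
    inner ℝ (WithLp.toLp 2 (V i)) (WithLp.toLp 2 (V i')) = (V * Vᵀ) i i' := by
  simp [PiLp.inner_apply, Matrix.mul_apply, mul_comm]

theorem frameOperator_toLp_row {n d : ℕ} (V : Matrix (Fin n) (Fin d) ℝ) :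
    frameOperator (fun i => WithLp.toLp 2 (V i)) = Vᵀ * V := by
  ext j j'
  simp [frameOperator, Matrix.sum_apply, Matrix.vecMulVec_apply, Matrix.mul_apply]

theorem log_natCast_le_three_mul_log_pow_three (d : ℕ) :
    Real.log d ≤ 3 * Real.log d ^ 3 := by
  rcases lt_or_ge d 2 with hd | hd
  · interval_cases d <;> simp
  · have hlog : Real.log 2 ≤ Real.log d := Real.log_le_log two_pos (by exact_mod_cast hd)
    have hsq : (0.6 : ℝ) ^ 2 ≤ Real.log d ^ 2 := by
      gcongr
      linarith [Real.log_two_gt_d9]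
    nlinarith [Real.log_natCast_nonneg d]

end FrameScaling

theorem theoremt_general :
    ∃ C : ℝ, 0 < C ∧ ∀ d n : ℕ, 1 ≤ d → d ≤ n →
      ∃ V : FrameScaling.Frame n d,
        FrameScaling.IsDoublyBalanced V ∧ (∀ i, ‖V i‖ = 1) ∧
        FrameScaling.angle V ≤ C * (Real.log n / d) := by
  refine ⟨256, by norm_num, fun d n hd hdn => ?_⟩
  obtain ⟨V, hV⟩ := FrameScaling.exists_isFlatTight hd hdn le_rfl
  have hunit (i : Fin n) : ‖(WithLp.toLp 2 (V i) : EuclideanSpace ℝ (Fin d))‖ = 1 := by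
    rw [norm_eq_sqrt_real_inner, FrameScaling.inner_toLp_row, hV.unit, Real.sqrt_one]
  refine ⟨fun i => WithLp.toLp 2 (V i),
    FrameScaling.isDoublyBalanced_of_frameOperator_eq hunit ?_, hunit, ?_⟩
  · rw [FrameScaling.frameOperator_toLp_row, hV.tight, Fintype.card_fin, Fintype.card_fin]
  · rw [← mul_div_assoc]
    refine FrameScaling.angle_le (by positivity) fun i i' h => ?_
    rw [FrameScaling.inner_toLp_row]
    exact hV.coherence h

theorem theoremt :
    ∃ c : ℝ, 0 < c ∧ ∃ C : ℝ, 0 < C ∧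
      (∀ d n : ℕ, 1 ≤ d → c * (d : ℝ) ^ ((4 : ℝ) / 3) ≤ (n : ℝ) →
        ∃ V : FrameScaling.Frame n d,
          FrameScaling.IsDoublyBalanced V ∧ (∀ i, ‖V i‖ = 1) ∧
          FrameScaling.angle V ≤
            C * (Real.log (n : ℝ) / (d : ℝ)
              + (d : ℝ) * Real.log (d : ℝ) ^ 3 / (n : ℝ))) ∧
      (∀ d : ℕ, 1 ≤ d →
        ∃ V : FrameScaling.Frame (d ^ 2) d,
          FrameScaling.IsDoublyBalanced V ∧ (∀ i, ‖V i‖ = 1) ∧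
          FrameScaling.angle V ≤ C * (Real.log (d : ℝ) ^ 3 / (d : ℝ))) := by
  obtain ⟨C, hC, hframe⟩ := theoremt_general
  refine ⟨1, one_pos, 6 * C, by positivity, fun d n hd hn => ?_, fun d hd => ?_⟩
  · have hdn : d ≤ n := by
      have hpow : (d : ℝ) ≤ (d : ℝ) ^ ((4 : ℝ) / 3) :=
        Real.self_le_rpow_of_one_le (by exact_mod_cast hd) (by norm_num)
      exact_mod_cast hpow.trans ((one_mul _).symm.trans_le hn)
    obtain ⟨V, hV, hunit, hangle⟩ := hframe d n hd hdn
    refine ⟨V, hV, hunit, hangle.trans ?_⟩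
    gcongr
    · linarith
    · exact le_add_of_nonneg_right (by positivity)
  · obtain ⟨V, hV, hunit, hangle⟩ := hframe d (d ^ 2) hd (Nat.le_self_pow two_ne_zero d)
    refine ⟨V, hV, hunit, hangle.trans ?_⟩
    calc C * (Real.log ((d ^ 2 : ℕ) : ℝ) / d) = C * (2 * Real.log d / d) := by simp
      _ ≤ C * (2 * (3 * Real.log d ^ 3) / d) := by
          gcongr
          exact FrameScaling.log_natCast_le_three_mul_log_pow_three d
      _ = 6 * C * (Real.log d ^ 3 / d) := by ring
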